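/- Let $0<\alpha<1$, and let $\mathcal G=(V,E,w)$ be a finite directed graph with node set $V=\{1,\dots,n\}$ and edge weights $w:E\to(0,\infty)$. Let $d_i=\sum_{j:(i,j)\in E}w(i,j)$, let $P=(p_{ij})$ be the transition matrix with $p_{ij}=w(i,j)/d_i$ if $(i,j)\in E$ and $p_{ij}=0$ otherwise, and let $\Pi=\alpha\,(I-(1-\alpha)P)^{-1}$ be the PageRank matrix for the restart probability $\alpha$. Let $\mathcal G_r=(V,E,w_r)$ be the reweighted graph with $w_r(i,j)=\dfrac{w(i,j)}{\frac{\alpha}{1-\alpha}\,d_i}$ for $(i,j)\in E$. For a weighted digraph with out-degrees $d_u$, the algorithm RandomForest is the following program. Initialize $InForest[u]\leftarrow$ false, $Next[u]\leftarrow -1$, $Root[u]\leftarrow 0$ for all nodes $u$. Then, for $i=1,\dots,n$: set $u\leftarrow i$; while not $InForest[u]$, draw $Rand()$ uniformly from $[0,1]$; if $Rand()\le 1/(1+d_u)$, set $InForest[u]\leftarrow$ true, $Root[u]\leftarrow u$, $Next[u]\leftarrow -1$; else set $Next[u]$ to a random out-neighbour of $u$, drawn with probability proportional to the weights of the edges out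 of $u$, and set $u\leftarrow Next[u]$. When this loop ends, set $r\leftarrow Root[u]$, $u\leftarrow i$, and while not $InForest[u]$, set $InForest[u]\leftarrow$ true, $Root[u]\leftarrow r$, $u\leftarrow Next[u]$. All random draws are independent. Finally return $Root$. **Theorem.** Run RandomForest on $\mathcal G_r$. Then $I-(1-\alpha)P$ is invertible, the program stops almost surely, and the number $T$ of steps of its random walk (the number of passes through the first while loop, that is, of calls of $Rand()$) has finite expectation, namely $$\mathbb E[T]=\operatorname{trace}(\Pi)\Bigl(1+\frac{1-\alpha}{\alpha}\Bigr)\le \frac{n}{\alpha}.$$ Moreover, the expected total running time of RandomForest on $\mathcal G_r$ is $O(n)$ for fixed $\alpha$: counting assignments, tests and calls of the two random primitives at unit cost, there is a constant $C$ that depends only on $\alpha$ such that for every $n\ge 1$ and every such graph $\mathcal G$ on $n$ nodes the expected number of operations executed before the program stops is at most $Cn$. -/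

import Mathlib

open MeasureTheory ProbabilityTheory

noncomputable section

/-- A finite directed graph on the nodes `0, …, n - 1` with positive edge weights. Self-loops are
allowed. The values of `w` off the edge set are irrelevant: they are never used. -/
structure WeightedDigraph (n : ℕ) extends Digraph (Fin n) where
  w : Fin n → Fin n → ℝ
  w_pos : ∀ i j, Adj i j → 0 < w i j

namespace WeightedDigraph

variable {n : ℕ}

open Classical in
/-- The weighted adjacency matrix `A`. -/
def adjMatrix (G : WeightedDigraph n) : Matrix (Fin n) (Fin n) ℝ :=
  Matrix.of fun i j => if G.Adj i j then G.w i j else 0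

theorem adjMatrix_nonneg (G : WeightedDigraph n) (i j : Fin n) : 0 ≤ G.adjMatrix i j := by
  simp only [adjMatrix, Matrix.of_apply]
  split_ifs with h
  · exact (G.w_pos i j h).le
  · exact le_rfl

/-- The (weighted) out-degree `d_i = ∑ j, A i j`. -/
def outDegree (G : WeightedDigraph n) (i : Fin n) : ℝ := ∑ j, G.adjMatrix i j

theorem outDegree_nonneg (G : WeightedDigraph n) (i : Fin n) : 0 ≤ G.outDegree i :=
  Finset.sum_nonneg fun j _ => G.adjMatrix_nonneg i j

theorem outDegree_pos (G : WeightedDigraph n) {i j : Fin n} (h : G.Adj i j) :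
    0 < G.outDegree i := by
  refine Finset.sum_pos' (fun j _ => G.adjMatrix_nonneg i j) ⟨j, Finset.mem_univ j, ?_⟩
  simpa [adjMatrix, h] using G.w_pos i j h

/-- The transition matrix `P`: `p_ij = w(i,j) / d_i` if `(i,j)` is an edge and `p_ij = 0` otherwise.
(The row of a node without outgoing edges is zero.) -/
def transitionMatrix (G : WeightedDigraph n) : Matrix (Fin n) (Fin n) ℝ :=
  Matrix.of fun i j => G.adjMatrix i j / G.outDegree i

/-- The PageRank matrix `Π = α (I - (1 - α) P)⁻¹` for the restart probability `α`. -/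
def pageRankMatrix (G : WeightedDigraph n) (α : ℝ) : Matrix (Fin n) (Fin n) ℝ :=
  α • (1 - (1 - α) • G.transitionMatrix)⁻¹

/-- The reweighted graph: the same nodes and edges, with the weights
`w_r(i,j) = w(i,j) / (α / (1 - α) * d_i)`. -/
def reweight (G : WeightedDigraph n) (α : ℝ) (h0 : 0 < α) (h1 : α < 1) : WeightedDigraph n where
  Adj := G.Adj
  w i j := G.w i j / (α / (1 - α) * G.outDegree i)
  w_pos i j h :=
    div_pos (G.w_pos i j h) (mul_pos (div_pos h0 (sub_pos.mpr h1)) (G.outDegree_pos h))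

/-- The outcome of the test `Rand() ≤ 1 / (1 + d_u)`, where `Rand()` is uniform on `[0,1]`: it is
`true` with probability `1 / (1 + d_u)`. -/
def coin (G : WeightedDigraph n) (u : Fin n) : PMF Bool :=
  PMF.ofFintype
    (fun b => ENNReal.ofReal (if b then 1 / (1 + G.outDegree u) else 1 - 1 / (1 + G.outDegree u)))
    (by
      have h := G.outDegree_nonneg u
      have h2 : 1 / (1 + G.outDegree u) ≤ 1 := by
        rw [div_le_one (by linarith)]; linarith
      rw [Fintype.sum_bool]
      simp only [if_true, Bool.false_eq_true, if_false]
      rw [← ENNReal.ofReal_add (by positivity) (by linarith)]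
      simp)

open Classical in
/-- `RandomNeighbor(G, u)`: the out-neighbour `v` of `u` is drawn with probability
`w(u,v) / ∑ j ∈ N(u), w(u,j)`. If `u` has no out-neighbour, the value is immaterial: the test
before the call succeeds with probability `1 / (1 + 0) = 1`, so no call takes place. -/
def randomNeighbor (G : WeightedDigraph n) (u : Fin n) : PMF (Fin n) :=
  if h : 0 < G.outDegree u then
    PMF.ofFintype (fun v => ENNReal.ofReal (G.adjMatrix u v / G.outDegree u))
      (by
        rw [← ENNReal.ofReal_sum_of_nonneg fun v _ => div_nonneg (G.adjMatrix_nonneg u v) h.le,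
          ← Finset.sum_div]
        change ENNReal.ofReal (G.outDegree u / G.outDegree u) = 1
        rw [div_self h.ne', ENNReal.ofReal_one])
  else PMF.pure u

end WeightedDigraph

/-! ### The program `RandomForest` as a randomized machine

```
 1  InForest[u] := false, Next[u] := -1, Root[u] := 0   for all nodes u
 2  for i = 1 to n
 3    u := i
 4    while not InForest[u]
 5      if Rand() <= 1 / (1 + d_u)
 6        InForest[u] := true;  Root[u] := u;  Next[u] := -1
 7      else
 8        Next[u] := RandomNeighbor(G, u);  u := Next[u]
 9    r := Root[u];  u := i
10    while not InForest[u]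
11      InForest[u] := true;  Root[u] := r;  u := Next[u]
12  return Root
```
-/

namespace RandomForest

/-- The three arrays of the program. The value `-1` of an entry of `Next` and the value `0` of an
entry of `Root` (which are not nodes) are `none`. -/
structure Memory (n : ℕ) where
  inForest : Fin n → Bool
  next : Fin n → Option (Fin n)
  root : Fin n → Option (Fin n)

/-- The place in the program, with the current values of the local variables. -/
inductive Control (n : ℕ)
  /-- Line 1, about to initialize the entries of the `k`-th node. -/
  | init (k : ℕ)
  /-- Line 2, the head of the `for` loop, with loop variable `i`. -/
  | forHead (i : ℕ)
  /-- Line 4, the head of the first `while` loop. -/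
  | walk (i u : Fin n)
  /-- Line 10, the head of the second `while` loop. -/
  | retrace (i u : Fin n) (r : Option (Fin n))
  /-- Line 12: the program has stopped. -/
  | halt

/-- A configuration of the machine. -/
structure Config (n : ℕ) where
  mem : Memory n
  ctrl : Control n

instance (n : ℕ) : MeasurableSpace (Config n) := ⊤

variable {n : ℕ}

/-- The effect of line 6. -/
def Memory.makeRoot (m : Memory n) (u : Fin n) : Memory n where
  inForest := Function.update m.inForest u true
  next := Function.update m.next u none
  root := Function.update m.root u (some u)

/-- One step of the machine. A step evaluates at most two branching conditions and executes at most
four further elementary operations (assignments and calls of the primitives `Rand`,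
`RandomNeighbor`). -/
def step (G : WeightedDigraph n) : Config n → PMF (Config n)
  | ⟨m, .init k⟩ =>
      if h : k < n then
        PMF.pure ⟨⟨Function.update m.inForest ⟨k, h⟩ false, Function.update m.next ⟨k, h⟩ none,
          Function.update m.root ⟨k, h⟩ none⟩, .init (k + 1)⟩
      else PMF.pure ⟨m, .forHead 0⟩
  | ⟨m, .forHead i⟩ =>
      if h : i < n then PMF.pure ⟨m, .walk ⟨i, h⟩ ⟨i, h⟩⟩ else PMF.pure ⟨m, .halt⟩
  | ⟨m, .walk i u⟩ =>
      if m.inForest u then PMF.pure ⟨m, .retrace i i (m.root u)⟩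
      else (G.coin u).bind fun b =>
        if b then PMF.pure ⟨m.makeRoot u, .walk i u⟩
        else (G.randomNeighbor u).bind fun v =>
          PMF.pure ⟨{ m with next := Function.update m.next u (some v) }, .walk i v⟩
  | ⟨m, .retrace i u r⟩ =>
      if m.inForest u then PMF.pure ⟨m, .forHead (i + 1)⟩
      else PMF.pure ⟨{ m with inForest := Function.update m.inForest u true,
                              root := Function.update m.root u r },
        .retrace i ((m.next u).getD u) r⟩
  | ⟨m, .halt⟩ => PMF.pure ⟨m, .halt⟩

/-- The configuration in which the program starts. -/
def start (n : ℕ) : Config n := ⟨⟨fun _ => false, fun _ => none, fun _ => none⟩, .init 0⟩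

/-- The Markov kernel of `step`. -/
def stepKernel (G : WeightedDigraph n) : Kernel (Config n) (Config n) where
  toFun c := (step G c).toMeasure
  measurable' := measurable_from_top

instance (G : WeightedDigraph n) : IsMarkovKernel (stepKernel G) :=
  ⟨fun c => PMF.toMeasure.isProbabilityMeasure (step G c)⟩

/-- The law of the run `(c₀, c₁, c₂, …)` of `RandomForest(G)`: the Markov chain that starts in
`start n` and moves according to `step G`. -/
def runLaw (G : WeightedDigraph n) : Measure (ℕ → Config n) :=
  Kernel.trajMeasure (X := fun _ => Config n) (Measure.dirac (start n)) fun t =>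
    (stepKernel G).comap (fun x : (i : Finset.Iic t) → Config n => x ⟨t, Finset.mem_Iic.mpr le_rfl⟩)
      (measurable_pi_apply _)

/-- The program has stopped. -/
def Halted (c : Config n) : Prop := c.ctrl = .halt

/-- From this configuration the body of the first `while` loop is entered: `Rand` is called and one
step of the random walk is made. -/
def WalkStep (c : Config n) : Prop := ∃ i u, c.ctrl = .walk i u ∧ c.mem.inForest u = false

/-- The number of steps of the random walk (passes through the first `while` loop, that is, calls
of `Rand`) in a run. -/
def walkTime (c : ℕ → Config n) : ENNReal := ({t | WalkStep (c t)}.encard : ENNReal)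

/-- The number of all machine steps that a run makes before it stops. -/
def totalTime (c : ℕ → Config n) : ENNReal := ({t | ¬ Halted (c t)}.encard : ENNReal)

end RandomForest

end

/-! On the reweighted graph the walk stops at a node with positive out-degree with probability `α`
and otherwise moves according to `P`; at a node without out-edges it stops surely. Its substochastic
matrix is therefore `Q = (1 - α) P` (`moveMatrix_reweight`), and the claim is that Wilson's
algorithm makes `trace (1 - Q)⁻¹` steps on average.

Instead of analysing the law of loop-erased walks, the proof uses an exact potential. At the start
of a branch it is the trace of the Green matrix over the set `D` of nodes outside the forest,
whatever the starting node. Inside a branch with current path `l`, compare with the trace over `D \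
l`, the value once `l` is frozen. The excess solves a linear equation: its boundary values on the
path are those of the truncated path, and its source is the probability of returning to the path,
because the steps of such an excursion are lost with the erased loop. Hence erasing a loop leaves
the potential unchanged (`wilsonPotential_append_cons`), and a walk step lowers its mean by exactly
`1` (`wilsonPotential_eq`, which rests on the rank-one update `greenTrace_insert`).

Telescoping over time bounds the expected number of walk steps by the trace. All other machine steps
are bounded by `5 n + 2` plus the walk steps (`overhead_step`), so the total time has finite mean
and the program halts almost surely. The potential is bounded and vanishes at the end, so the bound
is an equality (`lintegral_walkTime`). The row sums of `(1 - Q)⁻¹` are at most `1 / α`, which gives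
`n / α`. -/

noncomputable section

/-! ### Green matrices of killed walks. -/

namespace Matrix

variable {ι : Type*} [Fintype ι]

/-- Minimum principle for a nonnegative matrix whose row sums are less than `1`. -/
theorem nonneg_of_mulVec_le {A : Matrix ι ι ℝ} (hA : ∀ i j, 0 ≤ A i j)
    (hA1 : ∀ i, ∑ j, A i j < 1) {f : ι → ℝ} (hf : ∀ i, ∑ j, A i j * f j ≤ f i) (i : ι) :
    0 ≤ f i := by
  have : Nonempty ι := ⟨i⟩
  obtain ⟨k, hk⟩ := Finite.exists_min f
  refine le_trans ?_ (hk i)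
  by_contra! hneg
  have h : (∑ j, A k j) * f k ≤ f k := by
    rw [Finset.sum_mul]
    exact (Finset.sum_le_sum fun j _ => mul_le_mul_of_nonneg_left (hk j) (hA k j)).trans (hf k)
  nlinarith [hA1 k]

variable [DecidableEq ι]

/-- The minimum principle applies to a null vector and to its negative, so the kernel is trivial. -/
theorem isUnit_one_sub_of_rowSum_lt_one {A : Matrix ι ι ℝ} (hA : ∀ i j, 0 ≤ A i j)
    (hA1 : ∀ i, ∑ j, A i j < 1) : IsUnit (1 - A) := by
  rw [← mulVec_injective_iff_isUnit]
  have key : ∀ f : ι → ℝ, (1 - A) *ᵥ f = 0 → ∀ i, 0 ≤ f i := by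
    intro f hf
    refine nonneg_of_mulVec_le hA hA1 fun i => ?_
    have := congrFun hf i
    rw [sub_mulVec, one_mulVec] at this
    simp only [Pi.sub_apply, Pi.zero_apply, mulVec, dotProduct] at this
    linarith
  intro f g hfg
  have h : (1 - A) *ᵥ (f - g) = 0 := by rw [mulVec_sub]; exact sub_eq_zero.mpr hfg
  have h' : (1 - A) *ᵥ (g - f) = 0 := by rw [mulVec_sub]; exact sub_eq_zero.mpr hfg.symm
  funext i
  have h1 := key _ h i
  have h2 := key _ h' i
  simp only [Pi.sub_apply] at h1 h2
  linarith

/-- The matrix `Q` with the rows outside `D` replaced by zero. -/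
def restrictRows (Q : Matrix ι ι ℝ) (D : Finset ι) : Matrix ι ι ℝ :=
  Matrix.of fun i j => if i ∈ D then Q i j else 0

/-- The Green matrix of the walk with substochastic matrix `Q` that is absorbed outside `D`: for
`j ∈ D` the entry `(i, j)` is the expected number of visits to `j`, and for `j ∉ D` it is the
probability of absorption at `j`. -/
def green (Q : Matrix ι ι ℝ) (D : Finset ι) : Matrix ι ι ℝ := (1 - Q.restrictRows D)⁻¹

/-- The sum of the diagonal entries of the Green matrix over `D`. -/
def greenTrace (Q : Matrix ι ι ℝ) (D : Finset ι) : ℝ := ∑ v ∈ D, Q.green D v v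

/-- A nonnegative matrix whose row sums are less than `1`. -/
structure IsStrictlySubstochastic (Q : Matrix ι ι ℝ) : Prop where
  nonneg : ∀ i j, 0 ≤ Q i j
  rowSum_lt : ∀ i, ∑ j, Q i j < 1

namespace IsStrictlySubstochastic

variable {Q : Matrix ι ι ℝ}

theorem restrictRows (hQ : Q.IsStrictlySubstochastic) (D : Finset ι) :
    (Q.restrictRows D).IsStrictlySubstochastic where
  nonneg i j := by
    simp only [Matrix.restrictRows, of_apply]
    split_ifs
    exacts [hQ.nonneg i j, le_rfl]
  rowSum_lt i := by
    simp only [Matrix.restrictRows, of_apply]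
    split_ifs
    exacts [hQ.rowSum_lt i, by simp]

theorem isUnit_one_sub (hQ : Q.IsStrictlySubstochastic) : IsUnit (1 - Q) :=
  isUnit_one_sub_of_rowSum_lt_one hQ.nonneg hQ.rowSum_lt

theorem green_mulVec_apply (hQ : Q.IsStrictlySubstochastic) (D : Finset ι) (b : ι → ℝ) (i : ι) :
    (Q.green D *ᵥ b) i =
      b i + if i ∈ D then ∑ j, Q i j * (Q.green D *ᵥ b) j else 0 := by
  have h : (1 - Q.restrictRows D) *ᵥ (Q.green D *ᵥ b) = b := by
    rw [mulVec_mulVec, green, mul_nonsing_inv _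
      ((isUnit_iff_isUnit_det _).mp (hQ.restrictRows D).isUnit_one_sub), one_mulVec]
  have hi := congrFun h i
  rw [sub_mulVec, one_mulVec, Pi.sub_apply, sub_eq_iff_eq_add] at hi
  rw [hi]
  congr 1
  simp only [Matrix.restrictRows, mulVec, dotProduct, of_apply]
  split_ifs <;> simp

/-- Uniqueness for the first-step equation. Later identities between Green functions are proved by
checking that both sides solve the same equation. -/
theorem eq_green_mulVec (hQ : Q.IsStrictlySubstochastic) {D : Finset ι} {b f : ι → ℝ}
    (hf : ∀ i, f i = b i + if i ∈ D then ∑ j, Q i j * f j else 0) : f = Q.green D *ᵥ b := by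
  have h : (1 - Q.restrictRows D) *ᵥ f = b := by
    funext i
    rw [sub_mulVec, one_mulVec, Pi.sub_apply, hf i, add_sub_assoc, add_eq_left, sub_eq_zero]
    simp only [Matrix.restrictRows, mulVec, dotProduct, of_apply]
    split_ifs <;> simp
  rw [← h, mulVec_mulVec, green, nonsing_inv_mul _
      ((isUnit_iff_isUnit_det _).mp (hQ.restrictRows D).isUnit_one_sub), one_mulVec]

theorem green_mulVec_nonneg (hQ : Q.IsStrictlySubstochastic) (D : Finset ι) {b : ι → ℝ}
    (hb : ∀ i, 0 ≤ b i) (i : ι) : 0 ≤ (Q.green D *ᵥ b) i := by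
  refine nonneg_of_mulVec_le (hQ.restrictRows D).nonneg (hQ.restrictRows D).rowSum_lt
    (fun i => ?_) i
  rw [hQ.green_mulVec_apply D b i]
  simp only [Matrix.restrictRows, of_apply]
  split_ifs <;> simp [hb i]

theorem green_apply (hQ : Q.IsStrictlySubstochastic) (D : Finset ι) (i j : ι) :
    Q.green D i j =
      (if i = j then 1 else 0) + if i ∈ D then ∑ k, Q i k * Q.green D k j else 0 := by
  have h := hQ.green_mulVec_apply D (Pi.single j 1) i
  simpa only [mulVec_single_one, col_apply, Pi.single_apply] using h

theorem green_nonneg (hQ : Q.IsStrictlySubstochastic) (D : Finset ι) (i j : ι) :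
    0 ≤ Q.green D i j := by
  have h := hQ.green_mulVec_nonneg D (b := Pi.single j 1)
    (fun i => by rw [Pi.single_apply]; split_ifs <;> norm_num) i
  simpa only [mulVec_single_one, col_apply] using h

theorem greenTrace_nonneg (hQ : Q.IsStrictlySubstochastic) (D : Finset ι) :
    0 ≤ Q.greenTrace D := Finset.sum_nonneg fun _ _ => hQ.green_nonneg D _ _

/-- Only the row of `x` changes when `x` ceases to be absorbing, so a column of the new Green matrix
solves the old equation with one additional source at `x`. -/
theorem green_insert (hQ : Q.IsStrictlySubstochastic) {D : Finset ι} {x : ι} (hx : x ∉ D)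
    (i j : ι) : Q.green (insert x D) i j =
      Q.green D i j + (Q.green (insert x D) x j - if x = j then 1 else 0) * Q.green D i x := by
  have h : (fun i => Q.green (insert x D) i j) = Q.green D *ᵥ (Pi.single j 1 +
      (Q.green (insert x D) x j - if x = j then 1 else 0) • Pi.single x 1) := by
    refine hQ.eq_green_mulVec fun i => ?_
    simp only [Pi.add_apply, Pi.smul_apply, smul_eq_mul, Pi.single_apply]
    by_cases hi : i = x
    · subst hi
      simp [hx]
    · rw [hQ.green_apply]
      simp [hi]
  have hi := congrFun h i
  simpa only [mulVec_add, mulVec_smul, mulVec_single_one, Pi.add_apply, Pi.smul_apply, col_apply,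
    smul_eq_mul] using hi

/-- A renewal identity at `x`: the second factor on the left is the probability of not returning to
`x`, and the right side counts the step at `x` together with the later steps of an excursion that
returns. -/
theorem greenTrace_insert (hQ : Q.IsStrictlySubstochastic) {D : Finset ι} {x : ι} (hx : x ∉ D) :
    (Q.greenTrace (insert x D) - Q.greenTrace D) * (1 - ∑ z, Q x z * Q.green D z x) =
      1 + ∑ z, Q x z * (Q.green D *ᵥ fun v => if v ∈ D then Q.green D v x else 0) z := by
  have key : ∀ v, (Q.green (insert x D) x v - if x = v then 1 else 0) *
      (1 - ∑ z, Q x z * Q.green D z x) = ∑ z, Q x z * Q.green D z v := by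
    intro v
    have h1 := hQ.green_apply (insert x D) x v
    simp only [Finset.mem_insert_self, if_true] at h1
    have h2 : ∑ z, Q x z * Q.green (insert x D) z v = ∑ z, Q x z * Q.green D z v +
        (Q.green (insert x D) x v - if x = v then 1 else 0) * ∑ z, Q x z * Q.green D z x := by
      rw [Finset.mul_sum, ← Finset.sum_add_distrib]
      refine Finset.sum_congr rfl fun z _ => ?_
      rw [hQ.green_insert hx z v]
      ring
    rw [h2] at h1
    linarith
  have hxx := key x
  simp only [if_true] at hxx
  have hsum : ∑ v ∈ D, (Q.green (insert x D) v v - Q.green D v v) *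
      (1 - ∑ z, Q x z * Q.green D z x) =
      ∑ z, Q x z * (Q.green D *ᵥ fun v => if v ∈ D then Q.green D v x else 0) z := by
    have h1 : ∀ v ∈ D, (Q.green (insert x D) v v - Q.green D v v) *
        (1 - ∑ z, Q x z * Q.green D z x) = ∑ z, Q x z * Q.green D z v * Q.green D v x := by
      intro v _
      rw [hQ.green_insert hx v v, add_sub_cancel_left, mul_right_comm, key, Finset.sum_mul]
    rw [Finset.sum_congr rfl h1, Finset.sum_comm]
    refine Finset.sum_congr rfl fun z _ => ?_
    simp only [mulVec, dotProduct, mul_ite, mul_zero, Finset.sum_ite_mem, Finset.univ_inter,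
      Finset.mul_sum, mul_assoc]
  rw [← hsum, greenTrace, greenTrace, Finset.sum_insert hx, add_sub_assoc, add_mul,
    ← Finset.sum_sub_distrib, Finset.sum_mul]
  linarith

end IsStrictlySubstochastic

/-! ### The potential of Wilson's algorithm. -/

/-- The expected number of steps that Wilson's algorithm still makes when `D` is the set of the
nodes that were outside the forest at the beginning of the current branch, `l` is the loop-erased
path of the branch so far (without its end point, and in reverse order), and `y` is the position of
the random walk. -/
def wilsonPotential (Q : Matrix ι ι ℝ) (D : Finset ι) : List ι → ι → ℝ
  | [], _ => Q.greenTrace D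
  | x :: l, y => Q.greenTrace (D \ (x :: l).toFinset) +
      (Q.green (D \ (x :: l).toFinset) *ᵥ fun z =>
        if z ∈ x :: l then wilsonPotential Q D l z - Q.greenTrace (D \ (x :: l).toFinset)
        else if z ∈ D then
          (Q.green (D \ (x :: l).toFinset) *ᵥ fun v => if v ∈ x :: l then 1 else 0) z
        else 0) y

namespace IsStrictlySubstochastic

variable {Q : Matrix ι ι ℝ}

theorem wilsonPotential_cons_of_mem (hQ : Q.IsStrictlySubstochastic) (D : Finset ι) {l : List ι}
    {x y : ι} (hy : y ∈ x :: l) : Q.wilsonPotential D (x :: l) y = Q.wilsonPotential D l y := by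
  rw [wilsonPotential, hQ.green_mulVec_apply]
  have : y ∉ D \ (x :: l).toFinset := by simpa using fun _ h => by simpa [h] using hy
  rw [if_pos hy, if_neg this]
  ring

/-- Loop erasure: when the walk returns to a node of its path, the part of the path made since then
may be dropped. -/
theorem wilsonPotential_append_cons (hQ : Q.IsStrictlySubstochastic) (D : Finset ι)
    (l₁ l₂ : List ι) (y : ι) :
    Q.wilsonPotential D (l₁ ++ y :: l₂) y = Q.wilsonPotential D l₂ y := by
  induction l₁ with
  | nil => exact hQ.wilsonPotential_cons_of_mem D (by simp)
  | cons x l₁ ih => rw [← ih]; exact hQ.wilsonPotential_cons_of_mem D (by simp)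

theorem wilsonPotential_of_notMem (hQ : Q.IsStrictlySubstochastic) {D : Finset ι} {l : List ι}
    (hl : ∀ x ∈ l, x ∈ D) {y : ι} (hy : y ∉ D) :
    Q.wilsonPotential D l y = Q.greenTrace (D \ l.toFinset) := by
  cases l with
  | nil => simp [wilsonPotential]
  | cons x l =>
    rw [wilsonPotential, hQ.green_mulVec_apply, if_neg (fun h => hy (hl y h)), if_neg hy,
      if_neg (by simp [hy])]
    ring

theorem wilsonPotential_of_mem (hQ : Q.IsStrictlySubstochastic) {D : Finset ι} {l : List ι}
    {y : ι} (hy : y ∈ D) (hyl : y ∉ l) :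
    Q.wilsonPotential D l y - Q.greenTrace (D \ l.toFinset) =
      (Q.green (D \ l.toFinset) *ᵥ fun v => if v ∈ l then 1 else 0) y +
        ∑ z, Q y z * (Q.wilsonPotential D l z - Q.greenTrace (D \ l.toFinset)) := by
  cases l with
  | nil =>
    have : (fun v : ι => if v ∈ ([] : List ι) then (1 : ℝ) else 0) = 0 := by
      funext v; simp
    simp [wilsonPotential, this, -List.not_mem_nil]
  | cons x l =>
    have hmem : y ∈ D \ (x :: l).toFinset := by
      rw [Finset.mem_sdiff, List.mem_toFinset]; exact ⟨hy, hyl⟩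
    simp only [wilsonPotential, add_sub_cancel_left]
    rw [hQ.green_mulVec_apply _ _ y, if_neg hyl, if_pos hy, if_pos hmem]

/-- Needed to carry the first-step equation over to `ℝ≥0∞`, where `ENNReal.ofReal` is additive only
on nonnegative terms. It follows from the minimum principle on the complement of the path. -/
theorem wilsonPotential_nonneg (hQ : Q.IsStrictlySubstochastic) (D : Finset ι) (l : List ι) :
    ∀ y, 0 ≤ Q.wilsonPotential D l y := by
  induction l with
  | nil => exact fun _ => hQ.greenTrace_nonneg D
  | cons x l ih =>
    set E := D \ (x :: l).toFinset with hE
    refine nonneg_of_mulVec_le (hQ.restrictRows E).nonneg (hQ.restrictRows E).rowSum_lt fun y => ?_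
    have ht := hQ.greenTrace_nonneg E
    simp only [Matrix.restrictRows, of_apply]
    by_cases hyl : y ∈ x :: l
    · have : y ∉ E := by simpa [hE] using fun _ h => by simpa [h] using hyl
      simpa [this, hQ.wilsonPotential_cons_of_mem D hyl] using ih y
    · by_cases hy : y ∈ D
      · have hyE : y ∈ E := by rw [hE, Finset.mem_sdiff, List.mem_toFinset]; exact ⟨hy, hyl⟩
        have h := hQ.wilsonPotential_of_mem hy hyl
        rw [← hE] at h
        simp only [mul_sub, Finset.sum_sub_distrib, ← Finset.sum_mul] at h
        have ha : 0 ≤ (Q.green E *ᵥ fun v => if v ∈ x :: l then 1 else 0) y :=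
          hQ.green_mulVec_nonneg E (fun v => by split_ifs <;> norm_num) y
        have := mul_le_mul_of_nonneg_right (hQ.rowSum_lt y).le ht
        simp only [if_pos hyE]
        linarith
      · have hyE : y ∉ E := by simp [hE, hy]
        simp only [if_neg hyE, zero_mul, Finset.sum_const_zero]
        rw [wilsonPotential, ← hE, hQ.green_mulVec_apply, if_neg hyl, if_neg hy, if_neg hyE]
        linarith

/-- First-step equation: from `x` the walk is killed or absorbed in the forest, after which the
branch `x :: l` is frozen, or it moves on. -/
theorem wilsonPotential_eq (hQ : Q.IsStrictlySubstochastic) {D : Finset ι} {l : List ι} {x : ι}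
    (hl : ∀ z ∈ l, z ∈ D) (hx : x ∈ D) (hxl : x ∉ l) :
    Q.wilsonPotential D l x = 1 + ∑ y, Q x y * Q.wilsonPotential D (x :: l) y +
      (1 - ∑ y, Q x y) * Q.greenTrace (D \ (x :: l).toFinset) := by
  set E := D \ l.toFinset with hE
  set E' := D \ (x :: l).toFinset with hE'
  have hmem : ∀ y, y ∈ E ↔ y ∈ D ∧ y ∉ l := fun y => by simp [hE]
  have hmem' : ∀ y, y ∈ E' ↔ y ∈ D ∧ y ≠ x ∧ y ∉ l := fun y => by simp [hE']
  have hxE' : x ∉ E' := by simp [hmem']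
  have hins : insert x E' = E := by
    ext y
    by_cases hyx : y = x
    · simp [hyx, hmem, hx, hxl]
    · simp [hyx, hmem, hmem']
  have htrace := hQ.greenTrace_insert hxE'
  rw [hins] at htrace
  set δ := Q.greenTrace E - Q.greenTrace E' with hδ
  set a : ι → ℝ := Q.green E *ᵥ fun v => if v ∈ l then 1 else 0 with ha
  set a' : ι → ℝ := Q.green E' *ᵥ fun v => if v ∈ x :: l then 1 else 0 with ha'
  set c : ι → ℝ := fun i => Q.green E' i x with hc
  set s : ι → ℝ := Q.green E' *ᵥ fun v => if v ∈ E' then c v else 0 with hs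
  set ψ : ι → ℝ := fun y => Q.wilsonPotential D l y - Q.greenTrace E with hψ
  set ψ' : ι → ℝ := fun y => Q.wilsonPotential D (x :: l) y - Q.greenTrace E' with hψ'
  have a_apply : ∀ y, a y = (if y ∈ l then 1 else 0) + if y ∈ E then ∑ z, Q y z * a z else 0 :=
    fun y => hQ.green_mulVec_apply E _ y
  have c_apply : ∀ y, c y = (if y = x then 1 else 0) + if y ∈ E' then ∑ z, Q y z * c z else 0 :=
    fun y => hQ.green_apply E' y x
  have s_apply : ∀ y, s y = (if y ∈ E' then c y else 0) +
      if y ∈ E' then ∑ z, Q y z * s z else 0 :=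
    fun y => hQ.green_mulVec_apply E' _ y
  have ψ_apply : ∀ y, y ∈ D → y ∉ l → ψ y = a y + ∑ z, Q y z * ψ z :=
    fun y hy hyl => hQ.wilsonPotential_of_mem hy hyl
  have ψ_out : ∀ y, y ∉ D → ψ y = 0 := fun y hy => by
    simp only [hψ, hQ.wilsonPotential_of_notMem hl hy, ← hE, sub_self]
  -- A walk that meets `x :: l` either meets `l`, possibly by way of `x`, or reaches `x` first and
  -- never meets `l` afterwards.
  have a'_eq : a' = fun y => a y + (1 - a x) * c y := by
    refine (hQ.eq_green_mulVec fun y => ?_).symm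
    rw [c_apply y]
    by_cases hyx : y = x
    · subst hyx
      simp [hxE']
    · rw [a_apply y]
      by_cases hyl : y ∈ l
      · have h1 : y ∉ E := by simp [hmem, hyl]
        have h2 : y ∉ E' := by simp [hmem', hyl]
        simp [h1, h2, hyl, hyx]
      · have h1 : y ∈ E' ↔ y ∈ E := by simp [hmem, hmem', hyx]
        simp only [h1, hyl, hyx, List.mem_cons, or_self, if_false, zero_add]
        split_ifs
        · rw [Finset.mul_sum, ← Finset.sum_add_distrib]
          exact Finset.sum_congr rfl fun z _ => by ring
        · ring
  have ψ'_green : ψ' = Q.green E' *ᵥ fun z =>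
      if z ∈ x :: l then Q.wilsonPotential D l z - Q.greenTrace E'
      else if z ∈ D then a' z else 0 := by
    funext y
    simp only [hψ', wilsonPotential, ← hE', add_sub_cancel_left, ← ha']
  -- The right side solves the equation that characterizes `ψ'`. Here `δ` corrects for the different
  -- reference traces, and `s` is the mean number of steps inside `E'` on excursions that reach `x`.
  have ψ'_eq : ψ' = fun y => ψ y + δ * a' y + (1 - a x) * s y := by
    rw [ψ'_green]
    refine (hQ.eq_green_mulVec fun y => ?_).symm
    have a'_apply : a' y = (if y ∈ x :: l then 1 else 0) +
        if y ∈ E' then ∑ z, Q y z * a' z else 0 := hQ.green_mulVec_apply E' _ y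
    have hs := s_apply y
    by_cases hyl : y ∈ x :: l
    · have h1 : y ∉ E' := by
        rw [List.mem_cons] at hyl
        rw [hmem']
        tauto
      simp only [hyl, h1, if_true, if_false, add_zero] at a'_apply hs ⊢
      rw [a'_apply, hs]
      simp only [hψ, hδ]
      ring
    · have hyx : y ≠ x := fun h => hyl (by simp [h])
      have hyl' : y ∉ l := fun h => hyl (by simp [h])
      by_cases hy : y ∈ D
      · have h1 : y ∈ E' := (hmem' y).mpr ⟨hy, hyx, hyl'⟩
        simp only [hyl, hy, h1, if_true, if_false, zero_add] at a'_apply hs ⊢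
        have hsum : ∑ z, Q y z * (ψ z + δ * a' z + (1 - a x) * s z) =
            ∑ z, Q y z * ψ z + δ * ∑ z, Q y z * a' z + (1 - a x) * ∑ z, Q y z * s z := by
          rw [Finset.mul_sum, Finset.mul_sum, ← Finset.sum_add_distrib, ← Finset.sum_add_distrib]
          exact Finset.sum_congr rfl fun z _ => by ring
        have := congrFun a'_eq y
        rw [hsum, ψ_apply y hy hyl', hs, ← a'_apply, this]
        ring
      · have h1 : y ∉ E' := by simp [hmem', hy]
        simp only [hyl, hy, h1, if_false, add_zero] at a'_apply hs ⊢
        rw [a'_apply, hs, ψ_out y hy]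
        ring
  have hax := a_apply x
  rw [if_neg hxl, if_pos ((hmem x).mpr ⟨hx, hxl⟩), zero_add] at hax
  have hψx := ψ_apply x hx hxl
  have hQψ' : ∑ z, Q x z * ψ' z = ∑ z, Q x z * ψ z + δ * ∑ z, Q x z * a' z +
      (1 - a x) * ∑ z, Q x z * s z := by
    rw [Finset.mul_sum, Finset.mul_sum, ← Finset.sum_add_distrib, ← Finset.sum_add_distrib]
    exact Finset.sum_congr rfl fun z _ => by rw [ψ'_eq]; ring
  have hQa' : ∑ z, Q x z * a' z = a x + (1 - a x) * ∑ z, Q x z * c z := by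
    rw [hax, Finset.mul_sum, ← Finset.sum_add_distrib, ← hax]
    exact Finset.sum_congr rfl fun z _ => by rw [a'_eq]; ring
  have hsplit : ∑ z, Q x z * ψ' z = ∑ z, Q x z * Q.wilsonPotential D (x :: l) z -
      (∑ z, Q x z) * Q.greenTrace E' := by
    rw [Finset.sum_mul, ← Finset.sum_sub_distrib]
    exact Finset.sum_congr rfl fun z _ => by simp only [hψ']; ring
  have hψx' : Q.wilsonPotential D l x = ψ x + δ + Q.greenTrace E' := by
    simp only [hψ, hδ]; ring
  rw [hψx', hψx]
  rw [hQψ', hQa'] at hsplit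
  -- After elimination of `ψ'` and `a'`, what remains is the renewal identity at `x`, weighted by
  -- the probability of not meeting `l` from `x`.
  linear_combination (1 - a x) * htrace + hsplit

end IsStrictlySubstochastic

end Matrix

/-! ### Expectations in `ℝ≥0∞` under a `PMF`. -/

namespace PMF

open scoped ENNReal

variable {β γ : Type*}

/-- The expectation of a nonnegative function. -/
def expect (p : PMF β) (f : β → ℝ≥0∞) : ℝ≥0∞ := ∑' a, p a * f a

theorem expect_pure (a : β) (f : β → ℝ≥0∞) : (PMF.pure a).expect f = f a := by
  rw [expect, tsum_eq_single a fun b hb => by rw [pure_apply_of_ne _ _ hb, zero_mul],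
    pure_apply_self, one_mul]

theorem expect_bind (p : PMF β) (q : β → PMF γ) (f : γ → ℝ≥0∞) :
    (p.bind q).expect f = p.expect fun a => (q a).expect f := by
  simp only [expect, bind_apply, ← ENNReal.tsum_mul_right, ← ENNReal.tsum_mul_left]
  rw [ENNReal.tsum_comm]
  simp only [mul_assoc]

theorem expect_map (p : PMF β) (g : β → γ) (f : γ → ℝ≥0∞) :
    (p.map g).expect f = p.expect (f ∘ g) := by
  rw [← bind_pure_comp, expect_bind]
  simp [expect_pure, Function.comp_def]

theorem expect_add (p : PMF β) (f g : β → ℝ≥0∞) :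
    p.expect (fun a => f a + g a) = p.expect f + p.expect g := by
  simp only [expect, mul_add, ENNReal.tsum_add]

theorem expect_const_mul (p : PMF β) (c : ℝ≥0∞) (f : β → ℝ≥0∞) :
    p.expect (fun a => c * f a) = c * p.expect f := by
  simp only [expect, mul_left_comm _ c, ENNReal.tsum_mul_left]

theorem expect_const (p : PMF β) (c : ℝ≥0∞) : p.expect (fun _ => c) = c := by
  rw [expect, ENNReal.tsum_mul_right, tsum_coe, one_mul]

theorem expect_mono {p : PMF β} {f g : β → ℝ≥0∞} (h : ∀ a ∈ p.support, f a ≤ g a) :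
    p.expect f ≤ p.expect g := by
  refine ENNReal.tsum_le_tsum fun a => ?_
  by_cases ha : a ∈ p.support
  · exact mul_le_mul_right (h a ha) _
  · rw [(apply_eq_zero_iff p a).mpr ha, zero_mul, zero_mul]

theorem expect_congr {p : PMF β} {f g : β → ℝ≥0∞} (h : ∀ a ∈ p.support, f a = g a) :
    p.expect f = p.expect g :=
  le_antisymm (expect_mono fun a ha => (h a ha).le) (expect_mono fun a ha => (h a ha).ge)

theorem expect_fintype [Fintype β] (p : PMF β) (f : β → ℝ≥0∞) :
    p.expect f = ∑ a, p a * f a := tsum_fintype _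

theorem lintegral_toMeasure [MeasurableSpace β] (p : PMF β) {f : β → ℝ≥0∞} (hf : Measurable f) :
    ∫⁻ a, f a ∂p.toMeasure = p.expect f := by
  have h : p.toMeasure = Measure.sum fun a => p a • Measure.dirac a := by
    ext s hs
    rw [toMeasure_apply _ hs, Measure.sum_apply _ hs]
    refine tsum_congr fun a => ?_
    by_cases ha : a ∈ s <;> simp [ha, hs]
  rw [h, lintegral_sum_measure]
  simp only [lintegral_smul_measure, lintegral_dirac' _ hf, smul_eq_mul, expect]

end PMF

/-! ### One-time marginals of the run. -/

namespace RandomForest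

open scoped ENNReal

variable {n : ℕ}

/-- The law of the configuration after `t` steps. -/
def law (G : WeightedDigraph n) : ℕ → PMF (Config n)
  | 0 => PMF.pure (start n)
  | t + 1 => (law G t).bind (step G)

theorem map_eval_zero_runLaw (G : WeightedDigraph n) :
    (runLaw G).map (fun c => c 0) = Measure.dirac (start n) := by
  have h : (fun c : ℕ → Config n => c 0) =
      (fun x : (i : Finset.Iic 0) → Config n => x ⟨0, Finset.mem_Iic.mpr le_rfl⟩) ∘
        Preorder.frestrictLe (π := fun _ => Config n) 0 := rfl
  rw [h, ← Measure.map_map (measurable_pi_apply _) (by fun_prop), runLaw, Kernel.trajMeasure,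
    Measure.map_comp _ _ (by fun_prop), Kernel.traj_map_frestrictLe, Kernel.partialTraj_self,
    Measure.id_comp, Measure.map_map (measurable_pi_apply _) (by fun_prop)]
  exact Measure.map_id

theorem map_eval_succ_runLaw (G : WeightedDigraph n) (t : ℕ) :
    (runLaw G).map (fun c => c (t + 1)) =
      ((runLaw G).map fun c => c t).bind (stepKernel G) := by
  have h := Kernel.map_frestrictLe_trajMeasure_compProd_eq_map_trajMeasure
    (X := fun _ => Config n) (μ₀ := Measure.dirac (start n))
    (κ := fun t => (stepKernel G).comap
      (fun x : (i : Finset.Iic t) → Config n => x ⟨t, Finset.mem_Iic.mpr le_rfl⟩)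
      (measurable_pi_apply _)) (a := t)
  have h2 := congrArg Measure.snd h
  rw [Measure.snd_compProd, Measure.snd, Measure.map_map measurable_snd (by fun_prop)] at h2
  change _ = (runLaw G).map fun c => c (t + 1) at h2
  rw [← h2]
  ext s hs
  rw [Measure.bind_apply hs (Kernel.aemeasurable _), Measure.bind_apply hs (Kernel.aemeasurable _),
    lintegral_map (Kernel.measurable_coe _ hs) (by fun_prop),
    lintegral_map (Kernel.measurable_coe _ hs) (by fun_prop)]
  rfl

theorem map_eval_runLaw (G : WeightedDigraph n) (t : ℕ) :
    (runLaw G).map (fun c => c t) = (law G t).toMeasure := by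
  induction t with
  | zero => rw [map_eval_zero_runLaw, law, PMF.toMeasure_pure]
  | succ t ih =>
    rw [map_eval_succ_runLaw, ih]
    ext s hs
    rw [Measure.bind_apply hs (Kernel.aemeasurable _), law, PMF.toMeasure_bind_apply _ _ _ hs,
      PMF.lintegral_toMeasure _ measurable_from_top]
    rfl

/-- By Tonelli, expected occupation times depend only on the one-time marginals, so the trajectory
measure is not needed beyond this point except for almost sure halting. -/
theorem lintegral_encard_runLaw (G : WeightedDigraph n) (S : Set (Config n)) :
    ∫⁻ c, (({t | c t ∈ S}.encard : ℕ∞) : ℝ≥0∞) ∂(runLaw G) =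
      ∑' t, (law G t).expect (S.indicator 1) := by
  have h : ∀ c : ℕ → Config n, (({t | c t ∈ S}.encard : ℕ∞) : ℝ≥0∞) =
      ∑' t, S.indicator (1 : Config n → ℝ≥0∞) (c t) := by
    intro c
    rw [← ENNReal.tsum_set_one, tsum_subtype {t | c t ∈ S} fun _ => (1 : ℝ≥0∞)]
    rfl
  have hS : Measurable (S.indicator (1 : Config n → ℝ≥0∞)) := measurable_from_top
  simp only [h]
  rw [lintegral_tsum (f := fun t (c : ℕ → Config n) => S.indicator (1 : Config n → ℝ≥0∞) (c t))
    fun t => (hS.comp (measurable_pi_apply t)).aemeasurable]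
  refine tsum_congr fun t => ?_
  rw [← PMF.lintegral_toMeasure _ hS, ← map_eval_runLaw, lintegral_map hS (measurable_pi_apply t)]

end RandomForest

/-! ### The killed walk driven by the two random primitives. -/

namespace WeightedDigraph

variable {n : ℕ}

/-- The substochastic matrix of the walk that stops at `u` with probability `1 / (1 + d_u)` and
otherwise moves to a random out-neighbour. -/
def moveMatrix (G : WeightedDigraph n) : Matrix (Fin n) (Fin n) ℝ :=
  Matrix.of fun u v => G.adjMatrix u v / (1 + G.outDegree u)

theorem sum_moveMatrix (G : WeightedDigraph n) (u : Fin n) :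
    ∑ v, G.moveMatrix u v = 1 - 1 / (1 + G.outDegree u) := by
  have h := G.outDegree_nonneg u
  simp only [moveMatrix, Matrix.of_apply, ← Finset.sum_div]
  change G.outDegree u / _ = _
  field_simp
  ring

theorem isStrictlySubstochastic_moveMatrix (G : WeightedDigraph n) :
    G.moveMatrix.IsStrictlySubstochastic where
  nonneg u v := div_nonneg (G.adjMatrix_nonneg u v) (by linarith [G.outDegree_nonneg u])
  rowSum_lt u := by
    rw [sum_moveMatrix, sub_lt_self_iff]
    exact one_div_pos.mpr (by linarith [G.outDegree_nonneg u])

theorem adjMatrix_eq_zero (G : WeightedDigraph n) {u : Fin n} (h : G.outDegree u = 0)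
    (v : Fin n) : G.adjMatrix u v = 0 :=
  (Finset.sum_eq_zero_iff_of_nonneg fun v _ => G.adjMatrix_nonneg u v).mp h v (Finset.mem_univ v)

theorem coin_true (G : WeightedDigraph n) (u : Fin n) :
    G.coin u true = ENNReal.ofReal (1 - ∑ v, G.moveMatrix u v) := by
  rw [sum_moveMatrix, sub_sub_cancel]
  simp [coin, PMF.ofFintype_apply]

theorem coin_false_mul_randomNeighbor (G : WeightedDigraph n) (u v : Fin n) :
    G.coin u false * G.randomNeighbor u v = ENNReal.ofReal (G.moveMatrix u v) := by
  have hc : G.coin u false = ENNReal.ofReal (1 - 1 / (1 + G.outDegree u)) := by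
    simp [coin, PMF.ofFintype_apply]
  rw [hc, moveMatrix, Matrix.of_apply]
  rcases (G.outDegree_nonneg u).eq_or_lt with h | h
  · simp [G.adjMatrix_eq_zero h.symm, ← h]
  · rw [randomNeighbor, dif_pos h, PMF.ofFintype_apply, ← ENNReal.ofReal_mul]
    · congr 1
      field_simp
      ring
    · rw [sub_nonneg, div_le_one (by linarith)]
      linarith

end WeightedDigraph

/-! ### Invariants of the program and the one-step balance. -/

namespace RandomForest

open scoped ENNReal

variable {n : ℕ}

/-- The nodes outside the forest. -/
def Memory.unforested (m : Memory n) : Finset (Fin n) :=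
  Finset.univ.filter fun v => m.inForest v = false

theorem Memory.mem_unforested (m : Memory n) (v : Fin n) :
    v ∈ m.unforested ↔ m.inForest v = false := by simp [unforested]

theorem unforested_update (m : Memory n) (u : Fin n) {m' : Memory n}
    (h : m'.inForest = Function.update m.inForest u true) :
    m'.unforested = m.unforested.erase u := by
  ext v
  by_cases hv : v = u <;> simp [Memory.mem_unforested, h, hv]

/-- Following the pointers `next` from `i`, one passes through `l.reverse` and arrives at `u`. -/
def IsPath (next : Fin n → Option (Fin n)) (i : Fin n) : List (Fin n) → Fin n → Prop
  | [], u => u = i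
  | x :: l, u => next x = some u ∧ IsPath next i l x

theorem IsPath.congr {next next' : Fin n → Option (Fin n)} {i : Fin n} {l : List (Fin n)}
    {u : Fin n} (h : IsPath next i l u) (hn : ∀ x ∈ l, next' x = next x) :
    IsPath next' i l u := by
  induction l generalizing u with
  | nil => exact h
  | cons x l ih =>
    exact ⟨(hn x (by simp)).trans h.1, ih h.2 fun y hy => hn y (by simp [hy])⟩

theorem IsPath.of_append {next : Fin n → Option (Fin n)} {i : Fin n} {l₁ l₂ : List (Fin n)}
    {u x : Fin n} (h : IsPath next i (l₁ ++ x :: l₂) u) : IsPath next i l₂ x := by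
  induction l₁ generalizing u with
  | nil => exact h.2
  | cons y l₁ ih => exact ih h.2

theorem isPath_append_singleton {next : Fin n → Option (Fin n)} {i x : Fin n}
    {l : List (Fin n)} {u : Fin n} :
    IsPath next i (l ++ [x]) u ↔ x = i ∧ ∃ y, next x = some y ∧ IsPath next y l u := by
  induction l generalizing u with
  | nil => simp [IsPath, and_comm]
  | cons z l ih =>
    simp only [List.cons_append, IsPath, ih]
    constructor
    · rintro ⟨h1, h2, y, h3, h4⟩
      exact ⟨h2, y, h3, h1, h4⟩
    · rintro ⟨h2, y, h3, h1, h4⟩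
      exact ⟨h1, h2, y, h3, h4⟩

/-- `Remaining G c v` says that `c` satisfies the invariants of the program and that `v` is the
expected number of steps of the random walk that are still to be made from `c`. -/
def Remaining (G : WeightedDigraph n) : Config n → ℝ≥0∞ → Prop
  | ⟨m, .init _⟩, v => (∀ j, m.inForest j = false) ∧
      v = ENNReal.ofReal (G.moveMatrix.greenTrace m.unforested)
  | ⟨m, .forHead k⟩, v => (∀ j : Fin n, j < k → m.inForest j = true) ∧
      v = ENNReal.ofReal (G.moveMatrix.greenTrace m.unforested)
  | ⟨m, .walk i u⟩, v => (∀ j < i, m.inForest j = true) ∧ ∃ l, IsPath m.next i l u ∧ l.Nodup ∧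
      (∀ x ∈ l, x ∈ m.unforested) ∧ u ∉ l ∧
      v = ENNReal.ofReal (G.moveMatrix.wilsonPotential m.unforested l u)
  | ⟨m, .retrace i w _⟩, v => (∀ j < i, m.inForest j = true) ∧ (w = i ∨ m.inForest i = true) ∧
      ∃ l u, IsPath m.next w l u ∧ l.Nodup ∧ (∀ x ∈ l, x ∈ m.unforested) ∧ u ∉ m.unforested ∧
      v = ENNReal.ofReal (G.moveMatrix.greenTrace (m.unforested \ l.toFinset))
  | ⟨_, .halt⟩, v => v = 0

/-- There are finitely many sets of nodes and, thanks to `Nodup`, finitely many paths. -/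
theorem exists_forall_remaining_le (G : WeightedDigraph n) :
    ∃ M : ℝ≥0∞, M ≠ ⊤ ∧ ∀ c v, Remaining G c v → v ≤ M := by
  obtain ⟨M₁, h₁⟩ := Finite.exists_le (G.moveMatrix.greenTrace)
  obtain ⟨M₂, h₂⟩ := Finite.exists_le
    fun p : Finset (Fin n) × {l : List (Fin n) // l.Nodup} × Fin n =>
      G.moveMatrix.wilsonPotential p.1 p.2.1 p.2.2
  refine ⟨ENNReal.ofReal (max M₁ M₂), ENNReal.ofReal_ne_top, ?_⟩
  rintro ⟨m, _ | _ | ⟨i, u⟩ | _ | _⟩ v h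
  · exact h.2.trans_le (ENNReal.ofReal_le_ofReal ((h₁ _).trans (le_max_left _ _)))
  · exact h.2.trans_le (ENNReal.ofReal_le_ofReal ((h₁ _).trans (le_max_left _ _)))
  · obtain ⟨_, l, _, hl, _, _, rfl⟩ := h
    exact ENNReal.ofReal_le_ofReal ((h₂ ⟨m.unforested, ⟨l, hl⟩, u⟩).trans (le_max_right _ _))
  · obtain ⟨_, _, l, _, _, _, _, _, rfl⟩ := h
    exact ENNReal.ofReal_le_ofReal ((h₁ _).trans (le_max_left _ _))
  · exact h.trans_le bot_le

theorem remaining_halted {G : WeightedDigraph n} {c : Config n} {v : ℝ≥0∞}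
    (h : Remaining G c v) (hc : Halted c) : v = 0 := by
  obtain ⟨m, _⟩ := c
  simp only [Halted] at hc
  subst hc
  exact h

/-- One step of the machine, together with the change of the expected number of remaining steps of
the random walk. -/
def IsStepCoupling (G : WeightedDigraph n) (c : Config n) (v : ℝ≥0∞)
    (q : PMF (Config n × ℝ≥0∞)) : Prop :=
  q.map Prod.fst = step G c ∧ (∀ x ∈ q.support, Remaining G x.1 x.2) ∧
    v = {c | WalkStep c}.indicator 1 c + q.expect Prod.snd

theorem isStepCoupling_pure {G : WeightedDigraph n} {c c' : Config n} {v : ℝ≥0∞}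
    (hstep : step G c = PMF.pure c') (hc : ¬ WalkStep c) (hv : Remaining G c' v) :
    IsStepCoupling G c v (PMF.pure (c', v)) := by
  refine ⟨by rw [hstep, PMF.pure_map], fun x hx => ?_, ?_⟩
  · rw [PMF.mem_support_pure_iff] at hx
    subst hx
    exact hv
  · rw [PMF.expect_pure, Set.indicator_of_notMem (by simpa using hc), zero_add]

theorem exists_isStepCoupling_walk {G : WeightedDigraph n} {m : Memory n} {i u : Fin n}
    {v : ℝ≥0∞} (h : Remaining G ⟨m, .walk i u⟩ v) (hu : m.inForest u = false) :
    ∃ q, IsStepCoupling G ⟨m, .walk i u⟩ v q := by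
  obtain ⟨hi, l, hpath, hnodup, hl, hul, rfl⟩ := h
  have hQ := G.isStrictlySubstochastic_moveMatrix
  have huD := (m.mem_unforested u).mpr hu
  refine ⟨(G.coin u).bind fun b =>
    if b then PMF.pure (⟨m.makeRoot u, .walk i u⟩,
      ENNReal.ofReal (G.moveMatrix.greenTrace (m.unforested \ (u :: l).toFinset)))
    else (G.randomNeighbor u).bind fun v => PMF.pure
      (⟨{ m with next := Function.update m.next u (some v) }, .walk i v⟩,
        ENNReal.ofReal (G.moveMatrix.wilsonPotential m.unforested (u :: l) v)), ?_, ?_, ?_⟩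
  · rw [PMF.map_bind]
    simp only [step, hu, Bool.false_eq_true, if_false]
    congr 1
    funext b
    cases b <;> simp [PMF.map_bind, PMF.pure_map]
  · intro x hx
    obtain ⟨b, _, hx⟩ := (PMF.mem_support_bind_iff _ _ _).mp hx
    cases b
    · simp only [Bool.false_eq_true, if_false] at hx
      obtain ⟨v, _, hx⟩ := (PMF.mem_support_bind_iff _ _ _).mp hx
      rw [PMF.mem_support_pure_iff] at hx
      subst hx
      refine ⟨hi, ?_⟩
      -- If `v` is on the path (a self-loop `v = u` included), the new pointer closes a loop. The
      -- pointers that lead from `i` to `v` then form `l₂`, and the potential does not notice the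
      -- truncation.
      by_cases hv : v ∈ u :: l
      · obtain ⟨l₁, l₂, hsplit⟩ := List.append_of_mem hv
        have hpath' : IsPath (Function.update m.next u (some v)) i (u :: l) v :=
          ⟨by simp, hpath.congr fun x hx =>
            Function.update_of_ne (ne_of_mem_of_not_mem hx hul) _ _⟩
        have hnodup' : (u :: l).Nodup := List.nodup_cons.mpr ⟨hul, hnodup⟩
        have hl' : ∀ x ∈ u :: l, x ∈ m.unforested := by
          simpa using ⟨huD, hl⟩
        rw [hsplit] at hpath' hnodup' hl'
        have hvl₂ := (List.nodup_append.mp hnodup').2.1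
        rw [List.nodup_cons] at hvl₂
        refine ⟨l₂, hpath'.of_append, hvl₂.2, fun x hx => hl' x (by simp [hx]), hvl₂.1, ?_⟩
        rw [hsplit, hQ.wilsonPotential_append_cons]
        rfl
      · refine ⟨u :: l, ⟨by simp, hpath.congr fun x hx =>
          Function.update_of_ne (ne_of_mem_of_not_mem hx hul) _ _⟩, List.nodup_cons.mpr ⟨hul, hnodup⟩,
          ?_, hv, rfl⟩
        intro x hx
        rcases List.mem_cons.mp hx with rfl | hx
        exacts [huD, hl x hx]
    · simp only [if_true] at hx
      rw [PMF.mem_support_pure_iff] at hx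
      subst hx
      have hD : (m.makeRoot u).unforested = m.unforested.erase u := unforested_update m u rfl
      have hl' : ∀ x ∈ l, x ∈ (m.makeRoot u).unforested := fun x hx => by
        rw [hD, Finset.mem_erase]
        exact ⟨fun h => hul (h ▸ hx), hl x hx⟩
      refine ⟨fun j hj => ?_, l, hpath.congr fun x hx =>
        Function.update_of_ne (ne_of_mem_of_not_mem hx hul) _ _, hnodup, hl', hul, ?_⟩
      · by_cases hju : j = u <;> simp [Memory.makeRoot, hju, hi j hj]
      -- The new root has left the set of unforested nodes, so the walk now stands in the forest and
      -- the path is frozen.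
      · rw [hQ.wilsonPotential_of_notMem hl' (by simp [hD]), hD, List.toFinset_cons,
          Finset.sdiff_insert, Finset.erase_sdiff_comm]
  · have hW : WalkStep (⟨m, .walk i u⟩ : Config n) := ⟨i, u, rfl, hu⟩
    have ht := hQ.greenTrace_nonneg (m.unforested \ (u :: l).toFinset)
    have hp := hQ.wilsonPotential_nonneg m.unforested (u :: l)
    rw [Set.indicator_of_mem (by exact hW), PMF.expect_bind, PMF.expect_fintype, Fintype.sum_bool]
    simp only [if_true, Bool.false_eq_true, if_false, PMF.expect_pure, PMF.expect_bind,
      PMF.expect_fintype, Finset.mul_sum, ← mul_assoc, G.coin_true,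
      G.coin_false_mul_randomNeighbor, Pi.one_apply]
    simp only [← ENNReal.ofReal_mul (hQ.nonneg _ _)]
    rw [← ENNReal.ofReal_mul (sub_nonneg.mpr (hQ.rowSum_lt u).le),
      ← ENNReal.ofReal_sum_of_nonneg fun v _ => mul_nonneg (hQ.nonneg u v) (hp v),
      ← ENNReal.ofReal_add (mul_nonneg (sub_nonneg.mpr (hQ.rowSum_lt u).le) ht)
        (Finset.sum_nonneg fun v _ => mul_nonneg (hQ.nonneg u v) (hp v)),
      ← ENNReal.ofReal_one, ← ENNReal.ofReal_add zero_le_one (add_nonneg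
        (mul_nonneg (sub_nonneg.mpr (hQ.rowSum_lt u).le) ht)
        (Finset.sum_nonneg fun v _ => mul_nonneg (hQ.nonneg u v) (hp v)))]
    congr 1
    rw [hQ.wilsonPotential_eq hl huD hul]
    ring

theorem exists_isStepCoupling_retrace {G : WeightedDigraph n} {m : Memory n} {i w : Fin n}
    {r : Option (Fin n)} {v : ℝ≥0∞} (h : Remaining G ⟨m, .retrace i w r⟩ v) :
    ∃ q, IsStepCoupling G ⟨m, .retrace i w r⟩ v q := by
  have hW : ¬ WalkStep (⟨m, .retrace i w r⟩ : Config n) := by rintro ⟨_, _, h, _⟩; cases h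
  obtain ⟨hi, hw, l, u, hpath, hnodup, hl, hu, rfl⟩ := h
  -- The path is stored in reverse, so retracing consumes the list from its last entry.
  rcases l.eq_nil_or_concat' with rfl | ⟨l, x, rfl⟩
  · obtain rfl : u = w := hpath
    have huf : m.inForest u = true := by simpa [m.mem_unforested] using hu
    refine ⟨_, isStepCoupling_pure (c' := ⟨m, .forHead (i + 1)⟩)
      (by simp [step, huf]) hW ⟨fun j hj => ?_, by simp⟩⟩
    rcases (Nat.lt_succ_iff.mp hj).lt_or_eq with hj | hj
    · exact hi j hj
    · obtain rfl : j = i := Fin.ext hj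
      rcases hw with rfl | hw
      exacts [huf, hw]
  · obtain ⟨rfl, y, hy, hpath⟩ := isPath_append_singleton.mp hpath
    have hx := (m.mem_unforested x).mp (hl x (by simp))
    have hxl : x ∉ l := fun h => by
      simpa using (List.nodup_append.mp hnodup).2.2 x h x (by simp)
    set m' : Memory n := { m with
      inForest := Function.update m.inForest x true
      root := Function.update m.root x r } with hm'
    have hD : m'.unforested = m.unforested.erase x := unforested_update m x rfl
    have hmono : ∀ j, m.inForest j = true → m'.inForest j = true := fun j hj => by
      by_cases hjx : j = x <;> simp [hm', hjx, hj]
    refine ⟨_, isStepCoupling_pure (c' := ⟨m', .retrace i y r⟩) (by simp [step, hx, hy, hm']) hW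
      ⟨fun j hj => hmono j (hi j hj), Or.inr ?_, l, u, hpath,
        (List.nodup_append.mp hnodup).1, fun z hz => ?_, ?_, ?_⟩⟩
    -- The first retracing step marks `i` itself; this is what extends the invariant of the `for`
    -- loop to `i + 1`.
    · rcases hw with rfl | hw
      · simp [hm']
      · exact hmono i hw
    · rw [hD, Finset.mem_erase]
      exact ⟨fun h => hxl (h ▸ hz), hl z (by simp [hz])⟩
    · rw [hD]
      exact fun h => hu (Finset.mem_of_mem_erase h)
    · congr 2
      ext z
      simp [hD]
      tauto

theorem exists_isStepCoupling {G : WeightedDigraph n} {c : Config n} {v : ℝ≥0∞}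
    (h : Remaining G c v) : ∃ q, IsStepCoupling G c v q := by
  obtain ⟨m, k | k | ⟨i, u⟩ | ⟨i, w, r⟩ | _⟩ := c
  · have hW : ¬ WalkStep (⟨m, .init k⟩ : Config n) := by rintro ⟨_, _, h, _⟩; cases h
    by_cases hk : k < n
    · have hm : Function.update m.inForest ⟨k, hk⟩ false = m.inForest := by
        rw [Function.update_eq_self_iff, h.1]
      exact ⟨_, isStepCoupling_pure (c' := ⟨⟨m.inForest, Function.update m.next ⟨k, hk⟩ none,
        Function.update m.root ⟨k, hk⟩ none⟩, .init (k + 1)⟩) (by simp [step, hk, hm]) hW h⟩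
    · refine ⟨_, isStepCoupling_pure (c' := ⟨m, .forHead 0⟩) (by simp [step, hk]) hW ?_⟩
      exact ⟨fun j hj => absurd hj (Nat.not_lt_zero _), h.2⟩
  · have hW : ¬ WalkStep (⟨m, .forHead k⟩ : Config n) := by rintro ⟨_, _, h, _⟩; cases h
    by_cases hk : k < n
    · refine ⟨_, isStepCoupling_pure (c' := ⟨m, .walk ⟨k, hk⟩ ⟨k, hk⟩⟩) (by simp [step, hk]) hW ?_⟩
      exact ⟨fun j hj => h.1 j hj, [], rfl, List.nodup_nil, by simp, by simp, h.2⟩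
    · refine ⟨_, isStepCoupling_pure (c' := ⟨m, .halt⟩) (by simp [step, hk]) hW ?_⟩
      have : m.unforested = ∅ := by
        ext j
        simp [m.mem_unforested, h.1 j (j.2.trans_le (not_lt.mp hk))]
      change v = 0
      rw [h.2, this]
      simp [Matrix.greenTrace]
  · cases hu : m.inForest u
    · exact exists_isStepCoupling_walk h hu
    · have hW : ¬ WalkStep (⟨m, .walk i u⟩ : Config n) := by
        rintro ⟨_, _, h, h'⟩
        cases h
        simp [hu] at h'
      obtain ⟨hi, l, hpath, hnodup, hl, hul, rfl⟩ := h
      have huD : u ∉ m.unforested := by simp [m.mem_unforested, hu]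
      refine ⟨_, isStepCoupling_pure (c' := ⟨m, .retrace i i (m.root u)⟩) (by simp [step, hu]) hW
        ⟨hi, Or.inl rfl, l, u, hpath, hnodup, hl, huD, ?_⟩⟩
      rw [G.isStrictlySubstochastic_moveMatrix.wilsonPotential_of_notMem hl huD]
  · exact exists_isStepCoupling_retrace h
  · exact ⟨_, isStepCoupling_pure (c' := ⟨m, .halt⟩) (by simp only [step])
      (by rintro ⟨_, _, h, _⟩; cases h) h⟩

theorem remaining_start (G : WeightedDigraph n) :
    Remaining G (start n) (ENNReal.ofReal (G.moveMatrix.greenTrace Finset.univ)) := by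
  refine ⟨fun _ => rfl, ?_⟩
  congr 2
  ext j
  simp [Memory.mem_unforested]

end RandomForest

/-! ### Evaluation and bound of the Green trace. -/

namespace Matrix

variable {ι : Type*} [Fintype ι] [DecidableEq ι] {Q : Matrix ι ι ℝ}

theorem greenTrace_univ (Q : Matrix ι ι ℝ) :
    Q.greenTrace Finset.univ = ((1 - Q)⁻¹).trace := by
  have h : Q.restrictRows Finset.univ = Q := by ext i j; simp [restrictRows]
  simp only [greenTrace, green, h, trace, diag_apply]

/-- A walk killed at each step with probability at least `a` lives at most `1 / a` steps on average.
The minimum principle gives this bound for the row sums, which dominate the diagonal entries. -/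
theorem IsStrictlySubstochastic.greenTrace_le (hQ : Q.IsStrictlySubstochastic) {a : ℝ}
    (ha : 0 < a) (hQa : ∀ i, ∑ j, Q i j ≤ 1 - a) (D : Finset ι) :
    Q.greenTrace D ≤ D.card / a := by
  have hrow : ∀ i, 0 ≤ 1 / a - (Q.green D *ᵥ 1) i := by
    refine nonneg_of_mulVec_le (hQ.restrictRows D).nonneg (hQ.restrictRows D).rowSum_lt fun i => ?_
    have ha1 : 0 ≤ 1 / a * (1 - a - ∑ j, Q i j) :=
      mul_nonneg (one_div_pos.mpr ha).le (sub_nonneg.mpr (hQa i))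
    have hQ0 : 0 ≤ ∑ j, Q i j := Finset.sum_nonneg fun j _ => hQ.nonneg i j
    have haa : 1 / a * a = 1 := by field_simp
    rw [hQ.green_mulVec_apply D 1 i]
    simp only [Matrix.restrictRows, of_apply, Pi.one_apply]
    split_ifs
    · simp only [mul_sub, Finset.sum_sub_distrib, ← Finset.sum_mul]
      linarith
    · simp only [zero_mul, Finset.sum_const_zero]
      nlinarith [hQa i, one_div_pos.mpr ha]
  have hdiag : ∀ v ∈ D, Q.green D v v ≤ 1 / a := fun v _ => by
    have h1 : Q.green D v v ≤ (Q.green D *ᵥ 1) v := by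
      simp only [mulVec, dotProduct, Pi.one_apply, mul_one]
      exact Finset.single_le_sum (fun j _ => hQ.green_nonneg D v j) (Finset.mem_univ v)
    linarith [hrow v]
  refine (Finset.sum_le_sum hdiag).trans_eq ?_
  rw [Finset.sum_const, nsmul_eq_mul, mul_one_div]

end Matrix

/-! ### Summation over time: halting, walk steps and total steps. -/

namespace RandomForest

open scoped ENNReal
open Filter Topology

variable {n : ℕ}

/-- The telescoped balance. Values are carried along with configurations because `Remaining` is a
relation; that its value is unique is never needed. -/
theorem exists_coupling_law (G : WeightedDigraph n) (t : ℕ) :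
    ∃ q : PMF (Config n × ℝ≥0∞), q.map Prod.fst = law G t ∧
      (∀ x ∈ q.support, Remaining G x.1 x.2) ∧
      ENNReal.ofReal (G.moveMatrix.greenTrace Finset.univ) =
        ∑ s ∈ Finset.range t, (law G s).expect ({c | WalkStep c}.indicator 1) +
          q.expect Prod.snd := by
  induction t with
  | zero =>
    refine ⟨PMF.pure (start n, ENNReal.ofReal (G.moveMatrix.greenTrace Finset.univ)),
      by rw [PMF.pure_map, law], fun x hx => ?_, ?_⟩
    · rw [PMF.mem_support_pure_iff] at hx
      subst hx
      exact remaining_start G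
    · simp [PMF.expect_pure]
  | succ t ih =>
    obtain ⟨q, hq, hsupp, hv⟩ := ih
    have hex : ∀ x : Config n × ℝ≥0∞, ∃ p : PMF (Config n × ℝ≥0∞),
        x ∈ q.support → IsStepCoupling G x.1 x.2 p := fun x => by
      by_cases hx : x ∈ q.support
      · obtain ⟨p, hp⟩ := exists_isStepCoupling (hsupp x hx)
        exact ⟨p, fun _ => hp⟩
      · exact ⟨PMF.pure x, fun h => absurd h hx⟩
    choose f hf using hex
    refine ⟨q.bind f, ?_, fun y hy => ?_, ?_⟩
    · rw [PMF.map_bind, law, ← hq, PMF.bind_map]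
      ext c
      rw [PMF.bind_apply, PMF.bind_apply]
      refine tsum_congr fun x => ?_
      by_cases hx : x ∈ q.support
      · rw [(hf x hx).1]; rfl
      · rw [(PMF.apply_eq_zero_iff q x).mpr hx, zero_mul, zero_mul]
    · obtain ⟨x, hx, hy⟩ := (PMF.mem_support_bind_iff _ _ _).mp hy
      exact (hf x hx).2.1 y hy
    · have h : q.expect Prod.snd = (law G t).expect ({c | WalkStep c}.indicator 1) +
          (q.bind f).expect Prod.snd := by
        rw [PMF.expect_congr fun x hx => (hf x hx).2.2, PMF.expect_add, ← hq, PMF.expect_map,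
          PMF.expect_bind]
        rfl
      rw [hv, h, Finset.sum_range_succ, add_assoc]

/-- A bound for the number of the machine steps, other than the steps of the random walk, that are
still to be made. -/
def overhead : Config n → ℕ
  | ⟨_, .init k⟩ => (n - k) + 4 * n + 2
  | ⟨m, .forHead k⟩ => 1 + 3 * (n - k) + m.unforested.card
  | ⟨m, .walk i _⟩ => 3 * (n - i) + m.unforested.card
  | ⟨m, .retrace i _ _⟩ => 3 * (n - i) - 1 + m.unforested.card
  | ⟨_, .halt⟩ => 0

theorem Memory.card_unforested_le (m : Memory n) : m.unforested.card ≤ n := by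
  simpa using m.unforested.card_le_univ

/-- A walk step does not raise `overhead`, and every other step before the halt lowers it by at
least `1`. Each pass of the `for` loop pays for three loop tests (the head and the two exits), and
each retracing step is paid for by the node it adds to the forest. -/
theorem overhead_step (G : WeightedDigraph n) (c : Config n) :
    (step G c).expect (fun c => (overhead c : ℝ≥0∞)) + {c | ¬ Halted c}.indicator 1 c ≤
      overhead c + {c | WalkStep c}.indicator 1 c := by
  have pure_le : ∀ {c c' : Config n}, step G c = PMF.pure c' → overhead c' + 1 ≤ overhead c →
      (step G c).expect (fun c => (overhead c : ℝ≥0∞)) + {c | ¬ Halted c}.indicator 1 c ≤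
        overhead c + {c | WalkStep c}.indicator 1 c := by
    intro c c' hc hle
    rw [hc, PMF.expect_pure]
    refine le_trans ?_ (le_self_add : (overhead c : ℝ≥0∞) ≤ _)
    refine le_trans (add_le_add_right (Set.indicator_le_self _ _ _) _) ?_
    simp only [Pi.one_apply]
    exact_mod_cast hle
  obtain ⟨m, k | k | ⟨i, u⟩ | ⟨i, w, r⟩ | _⟩ := c
  · by_cases hk : k < n
    · refine pure_le (by simp only [step, hk, dif_pos]; rfl) ?_
      simp only [overhead]
      omega
    · refine pure_le (c' := ⟨m, .forHead 0⟩) (by simp [step, hk]) ?_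
      have := m.card_unforested_le
      simp only [overhead]
      omega
  · by_cases hk : k < n
    · refine pure_le (c' := ⟨m, .walk ⟨k, hk⟩ ⟨k, hk⟩⟩) (by simp [step, hk]) ?_
      simp only [overhead]
      omega
    · refine pure_le (c' := ⟨m, .halt⟩) (by simp [step, hk]) ?_
      simp only [overhead]
      omega
  · have hin := i.2
    cases hu : m.inForest u
    · have hW : (⟨m, .walk i u⟩ : Config n) ∈ {c : Config n | WalkStep c} := ⟨i, u, rfl, hu⟩
      rw [Set.indicator_of_mem hW]
      refine add_le_add ?_ (Set.indicator_le_self _ _ _)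
      refine (PMF.expect_mono fun c' hc' => ?_).trans_eq (PMF.expect_const (step G _) _)
      simp only [step, hu, Bool.false_eq_true, if_false] at hc'
      obtain ⟨b, _, hc'⟩ := (PMF.mem_support_bind_iff _ _ _).mp hc'
      cases b
      · simp only [Bool.false_eq_true, if_false] at hc'
        obtain ⟨v, _, hc'⟩ := (PMF.mem_support_bind_iff _ _ _).mp hc'
        rw [PMF.mem_support_pure_iff] at hc'
        subst hc'
        exact le_rfl
      · simp only [if_true] at hc'
        rw [PMF.mem_support_pure_iff] at hc'
        subst hc'
        simp only [overhead, unforested_update m u (m' := m.makeRoot u) rfl]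
        exact_mod_cast Nat.add_le_add_left (Finset.card_erase_le) _
    · refine pure_le (c' := ⟨m, .retrace i i (m.root u)⟩) (by simp [step, hu]) ?_
      simp only [overhead]
      omega
  · have hin := i.2
    cases hw : m.inForest w
    · refine pure_le (by simp only [step, hw, Bool.false_eq_true, if_false]; rfl) ?_
      simp only [overhead]
      have hmem := (m.mem_unforested w).mpr hw
      have hpos := Finset.card_pos.mpr ⟨w, hmem⟩
      rw [unforested_update m w rfl, Finset.card_erase_of_mem hmem]
      omega
    · refine pure_le (c' := ⟨m, .forHead (i + 1)⟩) (by simp [step, hw]) ?_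
      simp only [overhead]
      omega
  · have hH : (⟨m, .halt⟩ : Config n) ∉ {c : Config n | ¬ Halted c} := by simp [Halted]
    rw [Set.indicator_of_notMem hH]
    simp [step, PMF.expect_pure, overhead]

theorem sum_not_halted_le (G : WeightedDigraph n) (t : ℕ) :
    ∑ s ∈ Finset.range t, (law G s).expect ({c | ¬ Halted c}.indicator 1) +
        (law G t).expect (fun c => (overhead c : ℝ≥0∞)) ≤
      (5 * n + 2 : ℕ) + ∑ s ∈ Finset.range t, (law G s).expect ({c | WalkStep c}.indicator 1) := by
  induction t with
  | zero =>
    simp only [Finset.range_zero, Finset.sum_empty, zero_add, add_zero, law, PMF.expect_pure]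
    simp only [start, overhead]
    exact_mod_cast (by omega)
  | succ t ih =>
    rw [Finset.sum_range_succ, Finset.sum_range_succ, law, PMF.expect_bind, ← add_assoc]
    refine le_trans ?_ (add_le_add_left ih _)
    rw [add_assoc, add_assoc, ← PMF.expect_add, ← PMF.expect_add]
    refine add_le_add_right (PMF.expect_mono fun c _ => ?_) _
    rw [add_comm]
    exact overhead_step G c

theorem tsum_walkStep_le (G : WeightedDigraph n) :
    ∑' t, (law G t).expect ({c | WalkStep c}.indicator 1) ≤
      ENNReal.ofReal (G.moveMatrix.greenTrace Finset.univ) := by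
  refine ENNReal.tsum_le_of_sum_range_le fun t => ?_
  obtain ⟨q, -, -, hv⟩ := exists_coupling_law G t
  exact hv ▸ le_self_add

theorem tsum_not_halted_le (G : WeightedDigraph n) :
    ∑' t, (law G t).expect ({c | ¬ Halted c}.indicator 1) ≤
      (5 * n + 2 : ℕ) + ENNReal.ofReal (G.moveMatrix.greenTrace Finset.univ) := by
  refine ENNReal.tsum_le_of_sum_range_le fun t => ?_
  refine (le_self_add.trans (sum_not_halted_le G t)).trans (add_le_add_right ?_ _)
  exact (ENNReal.sum_le_tsum _).trans (tsum_walkStep_le G)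

theorem tendsto_not_halted (G : WeightedDigraph n) :
    Tendsto (fun t => (law G t).expect ({c | ¬ Halted c}.indicator 1)) atTop (𝓝 0) :=
  ENNReal.tendsto_atTop_zero_of_tsum_ne_top <| ne_top_of_le_ne_top
    (ENNReal.add_ne_top.mpr ⟨ENNReal.natCast_ne_top _, ENNReal.ofReal_ne_top⟩)
    (tsum_not_halted_le G)

/-- The expected number of steps of the random walk is the trace of the Green matrix. -/
theorem lintegral_walkTime (G : WeightedDigraph n) :
    ∫⁻ c, walkTime c ∂(runLaw G) =
      ENNReal.ofReal (G.moveMatrix.greenTrace Finset.univ) := by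
  refine (lintegral_encard_runLaw G {c | WalkStep c}).trans
    (le_antisymm (tsum_walkStep_le G) ?_)
  obtain ⟨M, hM, hle⟩ := exists_forall_remaining_le G
  -- For the lower bound, the mean remaining value at time `t` is at most `M` times the probability
  -- of not having halted, which tends to `0`.
  have hlim : Tendsto (fun t => ∑' t, (law G t).expect ({c | WalkStep c}.indicator 1) +
      M * (law G t).expect ({c | ¬ Halted c}.indicator 1)) atTop
      (𝓝 (∑' t, (law G t).expect ({c | WalkStep c}.indicator 1))) := by
    have h := ENNReal.Tendsto.const_mul (tendsto_not_halted G) (Or.inr hM)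
    simpa using h.const_add (∑' t, (law G t).expect ({c | WalkStep c}.indicator 1))
  refine ge_of_tendsto' hlim fun t => ?_
  obtain ⟨q, hq, hsupp, hv⟩ := exists_coupling_law G t
  rw [hv]
  refine add_le_add (ENNReal.sum_le_tsum _) ?_
  rw [← hq, PMF.expect_map, ← PMF.expect_const_mul]
  refine PMF.expect_mono fun x hx => ?_
  by_cases hx' : Halted x.1
  · rw [remaining_halted (hsupp x hx) hx']
    exact bot_le
  · simpa [hx'] using hle _ _ (hsupp x hx)

theorem lintegral_totalTime_le (G : WeightedDigraph n) :
    ∫⁻ c, totalTime c ∂(runLaw G) ≤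
      (5 * n + 2 : ℕ) + ENNReal.ofReal (G.moveMatrix.greenTrace Finset.univ) :=
  (lintegral_encard_runLaw G {c | ¬ Halted c}).trans_le (tsum_not_halted_le G)

theorem ae_exists_halted (G : WeightedDigraph n) : ∀ᵐ c ∂(runLaw G), ∃ t, Halted (c t) := by
  rw [ae_iff]
  refine le_antisymm (ge_of_tendsto' (tendsto_not_halted G) fun t => ?_) bot_le
  have hS : MeasurableSet {c : Config n | ¬ Halted c} := trivial
  rw [← PMF.lintegral_toMeasure _ measurable_from_top, lintegral_indicator_one hS,
    ← map_eval_runLaw, Measure.map_apply (measurable_pi_apply t) hS]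
  exact measure_mono fun c hc ht => hc ⟨t, ht⟩

end RandomForest

/-! ### The reweighted graph and the theorem. -/

namespace WeightedDigraph

variable {n : ℕ}

theorem moveMatrix_reweight (G : WeightedDigraph n) (α : ℝ) (h0 : 0 < α) (h1 : α < 1) :
    (G.reweight α h0 h1).moveMatrix = (1 - α) • G.transitionMatrix := by
  have h1' : 0 < 1 - α := sub_pos.mpr h1
  have hadj : ∀ u v, (G.reweight α h0 h1).adjMatrix u v =
      G.adjMatrix u v / (α / (1 - α) * G.outDegree u) := by
    intro u v
    by_cases h : G.Adj u v
    · have h' : (G.reweight α h0 h1).Adj u v := h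
      simp only [adjMatrix, Matrix.of_apply, if_pos h, if_pos h']
      rfl
    · have h' : ¬ (G.reweight α h0 h1).Adj u v := h
      simp only [adjMatrix, Matrix.of_apply, if_neg h, if_neg h', zero_div]
  ext u v
  simp only [moveMatrix, transitionMatrix, Matrix.of_apply, Matrix.smul_apply, smul_eq_mul, hadj]
  -- At a node without outgoing edges both rows vanish, by the convention `x / 0 = 0`.
  rcases (G.outDegree_nonneg u).eq_or_lt with h | h
  · simp [← h]
  · have hdeg : (G.reweight α h0 h1).outDegree u = (1 - α) / α := by
      simp only [outDegree, hadj, ← Finset.sum_div]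
      change G.outDegree u / (α / (1 - α) * G.outDegree u) = _
      field_simp
    rw [hdeg]
    field_simp
    ring

theorem sum_transitionMatrix_le (G : WeightedDigraph n) (u : Fin n) :
    ∑ v, G.transitionMatrix u v ≤ 1 := by
  simp only [transitionMatrix, Matrix.of_apply, ← Finset.sum_div]
  exact div_self_le_one (G.outDegree u)

end WeightedDigraph

end

theorem mainTheorem5 (α : ℝ) (h0 : 0 < α) (h1 : α < 1) :
    (∀ (n : ℕ) (G : WeightedDigraph n),
      IsUnit (1 - (1 - α) • G.transitionMatrix) ∧
      (∀ᵐ c ∂(RandomForest.runLaw (G.reweight α h0 h1)), ∃ t, RandomForest.Halted (c t)) ∧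
      ∫⁻ c, RandomForest.walkTime c ∂(RandomForest.runLaw (G.reweight α h0 h1)) < ⊤ ∧
      (∫⁻ c, RandomForest.walkTime c ∂(RandomForest.runLaw (G.reweight α h0 h1))).toReal =
        (G.pageRankMatrix α).trace * (1 + (1 - α) / α) ∧
      (G.pageRankMatrix α).trace * (1 + (1 - α) / α) ≤ (n : ℝ) / α) ∧
    ∃ C : NNReal, ∀ (n : ℕ), 1 ≤ n → ∀ G : WeightedDigraph n,
      ∫⁻ c, RandomForest.totalTime c ∂(RandomForest.runLaw (G.reweight α h0 h1)) ≤
        (C : ENNReal) * (n : ENNReal) := by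
  have hQ : ∀ (n : ℕ) (G : WeightedDigraph n),
      (G.reweight α h0 h1).moveMatrix.IsStrictlySubstochastic :=
    fun n G => (G.reweight α h0 h1).isStrictlySubstochastic_moveMatrix
  have hle : ∀ (n : ℕ) (G : WeightedDigraph n),
      (G.reweight α h0 h1).moveMatrix.greenTrace Finset.univ ≤ n / α := by
    intro n G
    refine ((hQ n G).greenTrace_le h0 (fun u => ?_) _).trans_eq (by simp)
    simp only [G.moveMatrix_reweight, Matrix.smul_apply, smul_eq_mul, ← Finset.mul_sum]
    exact mul_le_of_le_one_right (sub_pos.mpr h1).le (G.sum_transitionMatrix_le u)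
  have htrace : ∀ (n : ℕ) (G : WeightedDigraph n),
      (G.pageRankMatrix α).trace * (1 + (1 - α) / α) =
        (G.reweight α h0 h1).moveMatrix.greenTrace Finset.univ := by
    intro n G
    rw [Matrix.greenTrace_univ, G.moveMatrix_reweight, WeightedDigraph.pageRankMatrix,
      Matrix.trace_smul, smul_eq_mul]
    -- The factor `1 + (1 - α) / α = 1 / α` cancels the `α` in the PageRank matrix.
    field_simp
    ring
  refine ⟨fun n G => ⟨?_, RandomForest.ae_exists_halted _, ?_, ?_, ?_⟩, ?_⟩
  · rw [← G.moveMatrix_reweight α h0 h1]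
    exact (hQ n G).isUnit_one_sub
  · rw [RandomForest.lintegral_walkTime]
    exact ENNReal.ofReal_lt_top
  · rw [RandomForest.lintegral_walkTime, ENNReal.toReal_ofReal ((hQ n G).greenTrace_nonneg _),
      htrace]
  · rw [htrace]
    exact hle n G
  -- The `7` absorbs the overhead, as `5 n + 2 ≤ 7 n` for `n ≥ 1`; the term `1 / α` pays for the
  -- random walk.
  · refine ⟨7 + Real.toNNReal (1 / α), fun n hn G => ?_⟩
    refine (RandomForest.lintegral_totalTime_le _).trans ?_
    rw [ENNReal.coe_add, add_mul]
    refine add_le_add ?_ ?_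
    · exact_mod_cast (by omega : 5 * n + 2 ≤ 7 * n)
    · refine (ENNReal.ofReal_le_ofReal (hle n G)).trans_eq ?_
      rw [div_eq_mul_one_div, mul_comm, ENNReal.ofReal_mul (one_div_pos.mpr h0).le,
        ENNReal.ofReal_natCast]
      rfl
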